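/- Let $D$ be an integral domain satisfying the ascending chain condition on principal ideals (ACCP). Then there exist a set $\Omega$ and an additive submonoid $M$ of the $\mathbb{Q}$-vector space $\mathbb{Q}^{(\Omega)}$ of finitely supported families of rationals indexed by $\Omega$, such that $M$ is positive (every coordinate of every element of $M$ is non-negative), the monoid algebra $D[M]$ is an integral domain satisfying the ACCP, and for every nonempty subset $L \subseteq \mathbb{N}_{\ge 2}$, finite or infinite, there is a nonzero element $b \in D[M]$ with $\mathsf{L}(b) = L$. Here the length set $\mathsf{L}(b)$ is the set of all integers $\ell \ge 0$ such that $b$ is, up to a unit factor, a product of $\ell$ irreducible elements (atoms) of $D[M]$, counted with repetitions. -/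

import Mathlib

/-- The ascending chain condition on principal ideals: every ascending chain of principal ideals
stabilizes. -/
def SatisfiesACCP (R : Type*) [CommRing R] : Prop :=
  ∀ a : ℕ → R, (∀ n, Ideal.span {a n} ≤ Ideal.span {a (n + 1)}) →
    ∃ m, ∀ n, m ≤ n → Ideal.span {a n} = Ideal.span {a m}

/-- The set of factorizations of `b`: formal products (finite multisets) of atoms of the reduced
multiplicative monoid `Associates R` whose product is the class of `b` modulo units. -/
def factorizationSet {R : Type*} [CommRing R] (b : R) : Set (Multiset (Associates R)) :=
  {z | (∀ a ∈ z, Irreducible a) ∧ z.prod = Associates.mk b}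

/-- The length set of `b`: the numbers of atoms, counted with repetitions, in the factorizations
of `b`. -/
def lengthSet {R : Type*} [CommRing R] (b : R) : Set ℕ :=
  Multiset.card '' factorizationSet b

/-- The system of length sets of `R`: all length sets of nonzero elements. -/
def lengthSystem (R : Type*) [CommRing R] : Set (Set ℕ) :=
  {L | ∃ b : R, b ≠ 0 ∧ lengthSet b = L}

/-- A submonoid of the `ℚ`-vector space `ℚ^(Ω)` of finitely supported families is positive if it
lies in the positive cone of the coordinatewise order. -/
def IsPositiveSubmonoid {Ω : Type*} (M : AddSubmonoid (Ω →₀ ℚ)) : Prop :=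
  ∀ x ∈ M, ∀ i, 0 ≤ x i

/-! Write `e_L` for the basis vector of `L`. For each `l ∈ L` with `l ≥ 2`, take a prime `p` of its
own, large compared with `l`, and let `M` be generated by the vectors `(2/p) e_L` and `((p -
2(l-1))/p) e_L`. Then `l - 1` copies of the first and one of the second add up to `e_L`, a
factorization of length `l`.

There are no others. A sum of fractions `c k / p k` with natural `c k` equals `1` only if a single
prime occurs, with numerator `p k` (`eq_single_of_digitValue_eq_one`); parity and size then fix the
multiplicities (`eq_of_slotWeight_eq_slotPrime`). So `e_L` has length set `L` in `M`. In `D[M]` a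
divisor of a monomial with coefficient one is a monomial up to units, so `X^(e_L)` has the same
lengths (`lengthSet_single_one`).

For the ACCP, the digits `c k` are not determined by the value, but their remainders modulo `p k`
and the sum of their quotients are. This gives a well-founded rank on `M`, and `wfDvdMonoid_of_rank`
combines it with the ACCP of `D` through leading terms. -/

section ACCP

theorem satisfiesACCP_iff_wfDvdMonoid {R : Type*} [CommRing R] [IsDomain R] :
    SatisfiesACCP R ↔ WfDvdMonoid R := by
  constructor
  · intro h
    refine ⟨wellFounded_iff_isEmpty_descending_chain.2 ⟨fun ⟨a, ha⟩ ↦ ?_⟩⟩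
    have hlt : ∀ n, Ideal.span {a n} < Ideal.span {a (n + 1)} := fun n ↦
      Ideal.span_singleton_lt_span_singleton.2 (ha n)
    obtain ⟨m, hm⟩ := h a fun n ↦ (hlt n).le
    exact (hlt m).ne' (hm (m + 1) (Nat.le_succ m))
  · intro h a ha
    obtain ⟨_, ⟨m, rfl⟩, hm⟩ := h.wf.has_min (Set.range a) (Set.range_nonempty a)
    refine ⟨m, fun n hn ↦ ?_⟩
    have hle : Ideal.span {a m} ≤ Ideal.span {a n} :=
      monotone_nat_of_le_succ (f := fun n ↦ Ideal.span {a n}) ha hn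
    by_contra hne
    exact hm (a n) ⟨n, rfl⟩
      (Ideal.span_singleton_lt_span_singleton.1 (lt_of_le_of_ne hle (Ne.symm hne)))

end ACCP

/-! ### Monoid algebras: ACCP and factorizations of monomials -/

namespace AddMonoidAlgebra

variable {R A : Type*} [CommRing R] [AddCommMonoid A]

variable (R) in
/-- The class modulo units of a monomial with coefficient one. -/
noncomputable def monomialClass (a : A) : Associates (AddMonoidAlgebra R A) :=
  Associates.mk (single a 1)

theorem monomialClass_zero : monomialClass R (0 : A) = 1 := rfl

theorem monomialClass_add (a b : A) :
    monomialClass R (a + b) = monomialClass R a * monomialClass R b := by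
  simp [monomialClass, Associates.mk_mul_mk, single_mul_single]

theorem monomialClass_sum (t : Multiset A) :
    monomialClass R t.sum = (t.map (monomialClass R)).prod := by
  induction t using Multiset.induction with
  | empty => simp [monomialClass_zero]
  | cons a t ih => simp [monomialClass_add, ih]

variable [IsDomain R]

/-- If `A` embeds in a linearly ordered monoid as a set of non-negative elements, and if `A` has a
well-founded rank function that increases strictly along proper divisibility, then the ascending
chain condition on principal ideals passes from `R` to `R[A]`. -/
theorem wfDvdMonoid_of_rank [WfDvdMonoid R] {B α : Type*} [AddCommMonoid B] [LinearOrder B]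
    [OrderBot B] [AddLeftStrictMono B] [AddRightStrictMono B] (D : A →+ B)
    (hD : Function.Injective D) (hbot : (⊥ : B) = 0) [Preorder α] [WellFoundedLT α] (ρ : A → α)
    (hρ : ∀ a b, b ≠ 0 → ρ a < ρ (a + b)) : WfDvdMonoid (AddMonoidAlgebra R A) where
  wf := by
    classical
    have hex : ∀ f : AddMonoidAlgebra R A, ∃ a, f ≠ 0 → f.supDegree D = D a := fun f ↦ by
      by_cases hf : f = 0
      · exact ⟨0, fun h ↦ (h hf).elim⟩
      · obtain ⟨a, -, ha⟩ := exists_supDegree_mem_support D hf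
        exact ⟨a, fun _ ↦ ha⟩
    choose d hd using hex
    -- The rank of the leading exponent comes first, the leading coefficient second. Zero gets `⊤`
    -- because every nonzero element divides it properly.
    refine RelHomClass.wellFounded
      (⟨fun f : AddMonoidAlgebra R A ↦
          ((if f = 0 then ⊤ else ↑(ρ (d f)) : WithTop α), f.leadingCoeff D), ?_⟩ :
        DvdNotUnit →r Prod.Lex (· < ·) DvdNotUnit)
      (wellFounded_lt.prod_lex ‹WfDvdMonoid R›.wf)
    rintro f _ ⟨hf, g, hg, rfl⟩
    have hlc : (f * g).leadingCoeff D = f.leadingCoeff D * g.leadingCoeff D :=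
      leadingCoeff_mul hD (map_add D)
    have hf' := (leadingCoeff_ne_zero hD).2 hf
    rw [if_neg hf]
    by_cases hg0 : g = 0
    · rw [if_pos (by rw [hg0, mul_zero])]
      exact Prod.Lex.left _ _ (WithTop.coe_lt_top _)
    have hg' := (leadingCoeff_ne_zero hD).2 hg0
    have hfg : f * g ≠ 0 := by
      rw [← leadingCoeff_ne_zero hD, hlc]
      exact mul_ne_zero hf' hg'
    have hdeg : d (f * g) = d f + d g := hD <| by
      rw [map_add, ← hd _ hfg, ← hd _ hf, ← hd _ hg0,
        supDegree_mul hD (map_add D) (mul_ne_zero hf' hg') hf hg0]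
    rw [if_neg hfg, hdeg]
    by_cases hdg : d g = 0
    · rw [hdg, add_zero, hlc]
      refine Prod.Lex.right _ ⟨hf', _, fun hu ↦ hg ?_, rfl⟩
      -- The leading exponent of `g` is the least possible one, so `g` is constant; a unit leading
      -- coefficient would make `g` a unit.
      have hsingle : g = singleZeroRingHom (g.leadingCoeff D) := by
        have hsup : g.supDegree D = D 0 := by rw [hd g hg0, hdg]
        ext a
        rcases eq_or_ne a 0 with rfl | ha
        · rw [leadingCoeff, hsup, Function.leftInverse_invFun hD 0]
          simp
        · rw [coeff_eq_zero_of_not_le_supDegree (D := D)]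
          · simp [ha.symm]
          · rw [hsup, map_zero, ← hbot, le_bot_iff, hbot, ← map_zero D, hD.eq_iff]
            exact ha
      rw [hsingle]
      exact hu.map _
    · exact Prod.Lex.left _ _ (WithTop.coe_lt_coe.2 (hρ _ _ hdg))

/-- If a factor had two terms, two different pairs of exponents would have unique sums. Neither term
can cancel, so both sums equal `a`, against uniqueness. -/
theorem eq_single_of_mul_eq_single [TwoUniqueSums A] {f g : AddMonoidAlgebra R A} {a : A} {r : R}
    (hr : r ≠ 0) (h : f * g = single a r) : ∃ b s, f = single b s := by
  classical
  have hfg : f * g ≠ 0 := by simpa [h] using hr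
  have hf : f.coeff.support.Nonempty := by
    simpa [Finsupp.support_nonempty_iff] using left_ne_zero_of_mul hfg
  have hg : g.coeff.support.Nonempty := by
    simpa [Finsupp.support_nonempty_iff] using right_ne_zero_of_mul hfg
  have key : ∀ p ∈ f.coeff.support ×ˢ g.coeff.support,
      UniqueAdd f.coeff.support g.coeff.support p.1 p.2 → p.1 + p.2 = a := by
    intro p hp hu
    have h1 := coeff_mul_add_of_uniqueAdd hu
    rw [Finset.mem_product, Finsupp.mem_support_iff, Finsupp.mem_support_iff] at hp
    by_contra hne
    rw [h, coeff_single, Finsupp.single_eq_of_ne hne] at h1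
    exact mul_ne_zero hp.1 hp.2 h1.symm
  have hcard : f.coeff.support.card * g.coeff.support.card ≤ 1 := by
    by_contra! hlt
    obtain ⟨p, hp, q, hq, hpq, hup, huq⟩ := TwoUniqueSums.uniqueAdd_of_one_lt_card hlt
    have := hup (Finset.mem_product.1 hq).1 (Finset.mem_product.1 hq).2
      ((key q hq huq).trans (key p hp hup).symm)
    exact hpq (Prod.ext this.1 this.2).symm
  have hf1 : f.coeff.support.card = 1 :=
    le_antisymm ((Nat.le_mul_of_pos_right _ hg.card_pos).trans hcard) hf.card_pos
  obtain ⟨b, hb⟩ := Finsupp.card_support_eq_one'.1 hf1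
  obtain ⟨s, -, hs⟩ := hb
  exact ⟨b, s, by ext; simp [hs]⟩

theorem exists_isUnit_of_mul_eq_single_one [TwoUniqueSums A] {f g : AddMonoidAlgebra R A} {a : A}
    (h : f * g = single a 1) : ∃ b c r, IsUnit r ∧ b + c = a ∧ f = single b r := by
  obtain ⟨b, r, rfl⟩ := eq_single_of_mul_eq_single one_ne_zero h
  obtain ⟨c, s, rfl⟩ := eq_single_of_mul_eq_single one_ne_zero ((mul_comm _ _).trans h)
  rw [single_mul_single] at h
  have h' := congr_arg coeff h
  rw [coeff_single, coeff_single, Finsupp.single_eq_single_iff] at h'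
  rcases h' with ⟨hbc, hrs⟩ | ⟨-, h0⟩
  · exact ⟨b, c, r, IsUnit.of_mul_eq_one _ hrs, hbc, rfl⟩
  · exact (one_ne_zero h0).elim

variable [TwoUniqueSums A]

theorem exists_of_mul_eq_monomialClass {x y : Associates (AddMonoidAlgebra R A)} {a : A}
    (h : x * y = monomialClass R a) : ∃ b, x = monomialClass R b := by
  obtain ⟨f, rfl⟩ := Associates.mk_surjective x
  obtain ⟨g, rfl⟩ := Associates.mk_surjective y
  rw [Associates.mk_mul_mk, monomialClass, Associates.mk_eq_mk_iff_associated] at h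
  obtain ⟨u, hu⟩ := h
  rw [mul_assoc] at hu
  obtain ⟨b, -, r, hr, -, rfl⟩ := exists_isUnit_of_mul_eq_single_one hu
  refine ⟨b, Associates.mk_eq_mk_iff_associated.2
    (Associated.symm ⟨(hr.map singleZeroRingHom).unit, ?_⟩)⟩
  simp [single_mul_single]

variable [Subsingleton (AddUnits A)]

theorem monomialClass_injective : Function.Injective (monomialClass R : A → _) := by
  intro a b h
  rw [monomialClass, monomialClass, Associates.mk_eq_mk_iff_associated] at h
  obtain ⟨u, hu⟩ := h
  obtain ⟨c, d, r, -, hcd, hc⟩ :=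
    exists_isUnit_of_mul_eq_single_one (a := (0 : A)) (f := (u : AddMonoidAlgebra R A))
      (g := ((u⁻¹ : (AddMonoidAlgebra R A)ˣ) : AddMonoidAlgebra R A)) (by rw [Units.mul_inv, one_def])
  obtain rfl : c = 0 := (add_eq_zero.1 hcd).1
  rw [hc, single_mul_single, add_zero] at hu
  have h' := congr_arg coeff hu
  rw [coeff_single, coeff_single, Finsupp.single_eq_single_iff] at h'
  rcases h' with ⟨h', -⟩ | ⟨-, h0⟩
  · exact h'
  · exact (one_ne_zero h0).elim

theorem irreducible_monomialClass_iff {a : A} :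
    Irreducible (monomialClass R a) ↔ AddIrreducible a := by
  have hunit : ∀ b : A, IsUnit (monomialClass R b) ↔ IsAddUnit b := fun b ↦ by
    rw [Associates.isUnit_iff_eq_one, ← monomialClass_zero, monomialClass_injective.eq_iff,
      isAddUnit_iff_eq_zero]
  rw [irreducible_iff, addIrreducible_iff, hunit]
  refine and_congr_right fun _ ↦ ⟨fun h b c hbc ↦ ?_, fun h x y hxy ↦ ?_⟩
  · exact (or_congr (hunit b) (hunit c)).1 (h (hbc ▸ monomialClass_add b c))
  · obtain ⟨b, rfl⟩ := exists_of_mul_eq_monomialClass hxy.symm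
    obtain ⟨c, rfl⟩ := exists_of_mul_eq_monomialClass ((mul_comm _ _).trans hxy.symm)
    simpa only [hunit] using h (monomialClass_injective (hxy.trans (monomialClass_add b c).symm))

/-- The lengths of a monomial in `R[A]` are those of its exponent in `A`. -/
theorem lengthSet_single_one (a : A) :
    lengthSet (single a 1 : AddMonoidAlgebra R A) =
      Multiset.card '' {t : Multiset A | (∀ b ∈ t, AddIrreducible b) ∧ t.sum = a} := by
  ext n
  constructor
  · rintro ⟨z, ⟨hz, hprod⟩, rfl⟩
    have hmem : ∀ x ∈ z, x ∈ Set.range (monomialClass R : A → _) := fun x hx ↦ by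
      obtain ⟨y, hy⟩ := Multiset.dvd_prod hx
      obtain ⟨b, hb⟩ := exists_of_mul_eq_monomialClass (hy.symm.trans hprod)
      exact ⟨b, hb.symm⟩
    have : CanLift (Associates (AddMonoidAlgebra R A)) A (monomialClass R)
      (· ∈ Set.range (monomialClass R : A → _)) := ⟨fun _ h ↦ h⟩
    lift z to Multiset A using hmem with t
    refine ⟨t, ⟨fun b hb ↦ ?_, ?_⟩, (Multiset.card_map _ _).symm⟩
    · exact irreducible_monomialClass_iff.1 (hz _ (Multiset.mem_map_of_mem _ hb))
    · exact monomialClass_injective ((monomialClass_sum t).trans hprod)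
  · rintro ⟨t, ⟨ht, rfl⟩, rfl⟩
    refine ⟨t.map (monomialClass R), ⟨fun x hx ↦ ?_, (monomialClass_sum t).symm⟩,
      Multiset.card_map _ _⟩
    obtain ⟨b, hb, rfl⟩ := Multiset.mem_map.1 hx
    exact irreducible_monomialClass_iff.2 (ht b hb)

end AddMonoidAlgebra

/-! ### Ranks on finitely supported families and sums with prime denominators -/

theorem Finsupp.strictMono_sum {ι α β : Type*} [Zero α] [PartialOrder α] [AddCommMonoid β]
    [PartialOrder β] [IsOrderedCancelAddMonoid β] {r : ι → α → β} (h0 : ∀ i, r i 0 = 0)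
    (hr : ∀ i, StrictMono (r i)) : StrictMono fun f : ι →₀ α ↦ f.sum r := by
  classical
  intro f g hfg
  obtain ⟨hle, i, hi⟩ := Finsupp.lt_def.1 hfg
  change f.sum r < g.sum r
  rw [Finsupp.sum_of_support_subset f Finset.subset_union_left r fun i _ ↦ h0 i,
    Finsupp.sum_of_support_subset g (Finset.subset_union_right (s₁ := f.support)) r
      fun i _ ↦ h0 i]
  refine Finset.sum_lt_sum (fun j _ ↦ (hr j).monotone (hle j)) ⟨i, ?_, hr i hi⟩
  by_contra hi'
  rw [Finset.notMem_union, Finsupp.notMem_support_iff, Finsupp.notMem_support_iff] at hi'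
  rw [hi'.1, hi'.2] at hi
  exact lt_irrefl _ hi

theorem Finset.sum_toLex {ι α β : Type*} [AddCommMonoid α] [AddCommMonoid β] (s : Finset ι)
    (a : ι → α) (b : ι → β) :
    ∑ i ∈ s, toLex (a i, b i) = toLex (∑ i ∈ s, a i, ∑ i ∈ s, b i) := by
  classical
  induction s using Finset.induction_on with
  | empty => rfl
  | insert i s hi ih =>
    rw [Finset.sum_insert hi, Finset.sum_insert hi, Finset.sum_insert hi, ih, ← toLex_add,
      Prod.mk_add_mk]

/-- Multiplying by the product of the other primes, which is coprime to `p k`, makes every term but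
the `k`-th an integer. -/
theorem Int.prime_dvd_of_sum_div_eq_zero {ι : Type*} {s : Finset ι} {p : ι → ℕ}
    (hp : ∀ i ∈ s, (p i).Prime) (hinj : Set.InjOn p s) {d : ι → ℤ}
    (h : ∑ i ∈ s, (d i : ℚ) / p i = 0) {k : ι} (hk : k ∈ s) : (p k : ℤ) ∣ d k := by
  classical
  have hne : ∀ i ∈ s, (p i : ℚ) ≠ 0 := fun i hi ↦ Nat.cast_ne_zero.2 (hp i hi).ne_zero
  set Q : ℤ := ∏ j ∈ s.erase k, (p j : ℤ) with hQ
  have hcop : IsCoprime (p k : ℤ) Q := by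
    refine IsCoprime.prod_right fun j hj ↦ ?_
    rw [Nat.isCoprime_iff_coprime, Nat.coprime_primes (hp k hk) (hp j (Finset.mem_of_mem_erase hj))]
    exact fun he ↦ Finset.ne_of_mem_erase hj (hinj hk (Finset.mem_of_mem_erase hj) he).symm
  have hdvd : ∀ i ∈ s.erase k, ∃ e : ℤ, (d i : ℚ) / p i * Q = e := fun i hi ↦ by
    refine ⟨d i * ∏ j ∈ (s.erase k).erase i, (p j : ℤ), ?_⟩
    rw [hQ, ← Finset.mul_prod_erase _ _ hi]
    push_cast
    field_simp [hne i (Finset.mem_of_mem_erase hi)]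
  choose! e he using hdvd
  refine hcop.dvd_of_dvd_mul_right ⟨-∑ i ∈ s.erase k, e i, ?_⟩
  have h1 := congr_arg (· * (Q : ℚ)) h
  simp only [zero_mul, ← Finset.add_sum_erase s _ hk, add_mul, Finset.sum_mul] at h1
  rw [Finset.sum_congr rfl he] at h1
  have hpk := hne k hk
  have h2 : (d k : ℚ) * Q = p k * -∑ i ∈ s.erase k, (e i : ℚ) := by
    field_simp at h1
    linarith
  exact_mod_cast h2

/-! ### Digits over prime denominators -/

/-- A strictly increasing sequence of primes, the `l`-th of which exceeds `3 * l`. -/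
noncomputable def slotPrime (l : ℕ) : ℕ := Nat.nth Nat.Prime (3 * l)

theorem slotPrime_prime (l : ℕ) : (slotPrime l).Prime := Nat.prime_nth_prime _

theorem slotPrime_injective : Function.Injective slotPrime := fun a b h ↦ by
  have := Nat.nth_injective Nat.infinite_setOfPred_prime h
  omega

theorem lt_slotPrime (l : ℕ) : 3 * l + 2 ≤ slotPrime l := Nat.add_two_le_nth_prime _

theorem slotPrime_pos (l : ℕ) : 0 < slotPrime l := (slotPrime_prime l).pos

theorem cast_slotPrime_ne_zero (l : ℕ) : (slotPrime l : ℚ) ≠ 0 :=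
  Nat.cast_ne_zero.2 (slotPrime_pos l).ne'

/-- The rational number `∑ c k / p k` with the digits `c`, where `p k` is the `k`-th prime of
`slotPrime`. -/
noncomputable def digitValue : (ℕ →₀ ℕ) →+ ℚ :=
  Finsupp.liftAddHom fun k ↦
    (AddMonoidHom.mulRight ((slotPrime k : ℚ)⁻¹)).comp (Nat.castAddMonoidHom ℚ)

theorem digitValue_single (k n : ℕ) :
    digitValue (Finsupp.single k n) = n / slotPrime k := by
  simp [digitValue, div_eq_mul_inv]

theorem digitValue_eq_sum {c : ℕ →₀ ℕ} {s : Finset ℕ} (hs : c.support ⊆ s) :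
    digitValue c = ∑ k ∈ s, (c k : ℚ) / slotPrime k := by
  rw [digitValue, Finsupp.liftAddHom_apply, Finsupp.sum_of_support_subset c hs _ (by simp)]
  simp [div_eq_mul_inv]

theorem digitValue_nonneg (c : ℕ →₀ ℕ) : 0 ≤ digitValue c := by
  rw [digitValue_eq_sum subset_rfl]
  positivity

theorem digitValue_eq_zero_iff {c : ℕ →₀ ℕ} : digitValue c = 0 ↔ c = 0 := by
  refine ⟨fun h ↦ ?_, fun h ↦ by rw [h, map_zero]⟩
  rw [digitValue_eq_sum subset_rfl, Finset.sum_eq_zero_iff_of_nonneg fun _ _ ↦ by positivity] at h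
  ext k
  by_contra hk
  have := h k (Finsupp.mem_support_iff.2 hk)
  rw [div_eq_zero_iff, or_iff_left (cast_slotPrime_ne_zero k), Nat.cast_eq_zero] at this
  exact hk this

theorem mod_eq_of_digitValue_eq {c d : ℕ →₀ ℕ} (h : digitValue c = digitValue d) (k : ℕ) :
    c k % slotPrime k = d k % slotPrime k := by
  by_cases hk : k ∈ c.support ∪ d.support
  · rw [digitValue_eq_sum (Finset.subset_union_left (s₂ := d.support)),
      digitValue_eq_sum (Finset.subset_union_right (s₁ := c.support)), ← sub_eq_zero,
      ← Finset.sum_sub_distrib] at h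
    have := Int.prime_dvd_of_sum_div_eq_zero (p := slotPrime) (d := fun k ↦ (c k : ℤ) - d k)
      (fun i _ ↦ slotPrime_prime i) slotPrime_injective.injOn (by simpa [sub_div] using h) hk
    exact ((Nat.modEq_iff_dvd).2 this).symm
  · rw [Finset.notMem_union, Finsupp.notMem_support_iff, Finsupp.notMem_support_iff] at hk
    rw [hk.1, hk.2]

/-- Comparison with `1 = p k / p k` shows that `p k` divides a nonzero digit `c k`. That digit alone
contributes at least `1`, so nothing else is left. -/
theorem eq_single_of_digitValue_eq_one {c : ℕ →₀ ℕ} (h : digitValue c = 1) :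
    ∃ k, c = Finsupp.single k (slotPrime k) := by
  have hone : ∀ k, digitValue (Finsupp.single k (slotPrime k)) = 1 := fun k ↦ by
    rw [digitValue_single, div_self (cast_slotPrime_ne_zero k)]
  have hc : c ≠ 0 := by
    rintro rfl
    simp at h
  obtain ⟨k, hk⟩ := Finsupp.ne_iff.1 hc
  have hdvd : slotPrime k ∣ c k := by
    rw [Nat.dvd_iff_mod_eq_zero, mod_eq_of_digitValue_eq (h.trans (hone k).symm) k]
    simp
  have hle : Finsupp.single k (slotPrime k) ≤ c :=
    Finsupp.single_le_iff.2 (Nat.le_of_dvd (Nat.pos_of_ne_zero hk) hdvd)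
  obtain ⟨d, rfl⟩ := exists_add_of_le hle
  rw [map_add, hone, add_eq_left, digitValue_eq_zero_iff] at h
  exact ⟨k, by rw [h, add_zero]⟩

/-- The sums of the quotients and of the remainders of the digits modulo their primes. -/
noncomputable def digitRank (c : ℕ →₀ ℕ) : ℕ ×ₗ ℕ :=
  c.sum fun k n ↦ toLex (n / slotPrime k, n % slotPrime k)

theorem digitRank_strictMono : StrictMono digitRank :=
  Finsupp.strictMono_sum (fun k ↦ by simp) fun k m n hmn ↦ by
    rw [Prod.Lex.toLex_lt_toLex]
    rcases (Nat.div_le_div_right (c := slotPrime k) hmn.le).lt_or_eq with h | h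
    · exact .inl h
    · refine .inr ⟨h, ?_⟩
      have hm := Nat.div_add_mod m (slotPrime k)
      have hn := Nat.div_add_mod n (slotPrime k)
      simp only at h ⊢
      rw [h] at hm
      omega

/-- The remainders agree by `mod_eq_of_digitValue_eq`; subtracting their fractions from the value
leaves the sum of the quotients. -/
theorem digitRank_eq_of_digitValue_eq {c d : ℕ →₀ ℕ} (h : digitValue c = digitValue d) :
    digitRank c = digitRank d := by
  set s := c.support ∪ d.support
  have hc : c.support ⊆ s := Finset.subset_union_left
  have hd : d.support ⊆ s := Finset.subset_union_right
  have hsplit : ∀ {c : ℕ →₀ ℕ}, c.support ⊆ s → digitValue c =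
      (∑ k ∈ s, c k / slotPrime k : ℕ) + ∑ k ∈ s, ((c k % slotPrime k : ℕ) : ℚ) / slotPrime k := by
    intro c hc
    rw [digitValue_eq_sum hc, Nat.cast_sum, ← Finset.sum_add_distrib]
    refine Finset.sum_congr rfl fun k _ ↦ ?_
    have hk := cast_slotPrime_ne_zero k
    field_simp
    exact_mod_cast (Nat.div_add_mod (c k) (slotPrime k)).symm
  have hmod := mod_eq_of_digitValue_eq h
  rw [hsplit hc, hsplit hd] at h
  simp only [hmod] at h
  rw [add_left_inj, Nat.cast_inj] at h
  have hsum : ∀ {c : ℕ →₀ ℕ}, c.support ⊆ s →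
      digitRank c = ∑ k ∈ s, toLex (c k / slotPrime k, c k % slotPrime k) := fun hc ↦
    Finsupp.sum_of_support_subset _ hc _ fun k _ ↦ by simp
  rw [hsum hc, hsum hd, Finset.sum_toLex, Finset.sum_toLex, h]
  simp only [hmod]

/-! ### Families of digits and the ACCP for submonoids of their values -/

section Family

variable {Ω : Type*}

/-- The coordinatewise version of `digitValue`. -/
noncomputable def familyValue : (Ω →₀ ℕ →₀ ℕ) →+ (Ω →₀ ℚ) :=
  Finsupp.mapRange.addMonoidHom digitValue

@[simp]
theorem familyValue_apply (f : Ω →₀ ℕ →₀ ℕ) (i : Ω) : familyValue f i = digitValue (f i) := rfl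

theorem familyValue_single (i : Ω) (c : ℕ →₀ ℕ) :
    familyValue (Finsupp.single i c) = Finsupp.single i (digitValue c) :=
  Finsupp.mapRange_single (hf := map_zero digitValue)

/-- The sum of the ranks of the coordinates. -/
noncomputable def familyRank (f : Ω →₀ ℕ →₀ ℕ) : ℕ ×ₗ ℕ := f.sum fun _ c ↦ digitRank c

theorem familyRank_strictMono : StrictMono (familyRank : (Ω →₀ ℕ →₀ ℕ) → _) :=
  Finsupp.strictMono_sum (fun _ ↦ Finsupp.sum_zero_index) fun _ ↦ digitRank_strictMono

theorem familyRank_eq_of_familyValue_eq {f g : Ω →₀ ℕ →₀ ℕ} (h : familyValue f = familyValue g) :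
    familyRank f = familyRank g := by
  classical
  rw [familyRank, familyRank,
    Finsupp.sum_of_support_subset f Finset.subset_union_left _ fun _ _ ↦ Finsupp.sum_zero_index,
    Finsupp.sum_of_support_subset g (Finset.subset_union_right (s₁ := f.support)) _
      fun _ _ ↦ Finsupp.sum_zero_index]
  exact Finset.sum_congr rfl fun i _ ↦ digitRank_eq_of_digitValue_eq (DFunLike.congr_fun h i)

variable {M : AddSubmonoid (Ω →₀ ℚ)}

theorem isPositiveSubmonoid_of_le_mrange (hM : M ≤ AddMonoidHom.mrange familyValue) :
    IsPositiveSubmonoid M := by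
  intro x hx i
  obtain ⟨f, rfl⟩ := hM hx
  exact digitValue_nonneg _

theorem wfDvdMonoid_addMonoidAlgebra_of_le_mrange {R : Type*} [CommRing R] [IsDomain R]
    [WfDvdMonoid R] (hM : M ≤ AddMonoidHom.mrange familyValue) :
    WfDvdMonoid (AddMonoidAlgebra R M) := by
  classical
  let _ : LinearOrder Ω := linearOrderOfSTO WellOrderingRel
  have hpos := isPositiveSubmonoid_of_le_mrange hM
  have hlift : ∀ x : M, ∃ f, familyValue f = (x : Ω →₀ ℚ) := fun x ↦ hM x.2
  choose lift hlift using hlift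
  -- Positivity allows coordinates in `NNRat`, so that the lexicographic order has `0` as its
  -- bottom.
  let D : M →+ Lex (Ω →₀ NNRat) :=
    { toFun := fun x ↦ toLex ((x : Ω →₀ ℚ).mapRange Rat.toNNRat Rat.toNNRat_zero)
      map_zero' := by
        rw [ZeroMemClass.coe_zero, Finsupp.mapRange_zero, toLex_zero]
      map_add' := fun x y ↦ by
        rw [← toLex_add]
        congr 1
        ext i
        simp [Rat.toNNRat_add (hpos x x.2 i) (hpos y y.2 i)] }
  have hD : Function.Injective D := fun x y hxy ↦ by
    ext i
    have h := DFunLike.congr_fun (toLex.injective hxy) i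
    rw [← Rat.coe_toNNRat _ (hpos x x.2 i), ← Rat.coe_toNNRat _ (hpos y y.2 i)]
    exact congr_arg _ h
  refine AddMonoidAlgebra.wfDvdMonoid_of_rank D hD rfl (fun x ↦ familyRank (lift x))
    fun x y hy ↦ ?_
  have hadd : familyRank (lift (x + y)) = familyRank (lift x + lift y) := by
    refine familyRank_eq_of_familyValue_eq ?_
    rw [map_add, hlift, hlift, hlift, AddMemClass.coe_add]
  change familyRank (lift x) < familyRank (lift (x + y))
  rw [hadd]
  refine familyRank_strictMono (lt_add_of_pos_right _ (pos_iff_ne_zero.2 fun h0 ↦ hy ?_))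
  ext1
  rw [← hlift, h0, map_zero, ZeroMemClass.coe_zero]

theorem subsingleton_addUnits_of_isPositiveSubmonoid (hM : IsPositiveSubmonoid M) :
    Subsingleton (AddUnits M) := by
  refine ⟨fun u v ↦ ?_⟩
  have hzero : ∀ u : AddUnits M, u = 0 := fun u ↦ by
    ext i
    have h : ((u : M) : Ω →₀ ℚ) i + (((-u : AddUnits M) : M) : Ω →₀ ℚ) i = 0 :=
      DFunLike.congr_fun (congr_arg Subtype.val u.add_neg) i
    have h1 := hM _ (u : M).2 i
    have h2 := hM _ ((-u : AddUnits M) : M).2 i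
    rw [AddUnits.val_zero, ZeroMemClass.coe_zero, Finsupp.zero_apply]
    linarith
  rw [hzero u, hzero v]

theorem twoUniqueSums_addSubmonoid {G : Type*} [AddCommGroup G] [Module ℚ G]
    (M : AddSubmonoid G) : TwoUniqueSums M :=
  TwoUniqueSums.of_injective_addHom (M.subtype : M →ₙ+ G) Subtype.val_injective inferInstance

end Family

/-! ### The monoid with prescribed length sets -/

theorem Multiset.exists_eq_replicate_add_replicate {α : Type*} {u v : α} {s : Multiset α}
    (h : ∀ a ∈ s, a = u ∨ a = v) : ∃ m n, s = replicate m u + replicate n v := by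
  induction s using Multiset.induction with
  | empty => exact ⟨0, 0, by simp⟩
  | cons a s ih =>
    obtain ⟨m, n, rfl⟩ := ih fun b hb ↦ h b (mem_cons_of_mem hb)
    rcases h a (mem_cons_self a _) with rfl | rfl
    · exact ⟨m + 1, n, by rw [replicate_succ, cons_add]⟩
    · exact ⟨m, n + 1, by rw [replicate_succ, add_cons]⟩

/-- The pairs of a set of natural numbers and one of its elements that is at least two. -/
abbrev Slot : Type := {q : Set ℕ × ℕ // q.2 ∈ q.1 ∧ 2 ≤ q.2}

/-- The numerators of the two generators that belong to the length `l`. They are `2` and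
the number that completes `l - 1` summands `2` to the prime `slotPrime l`. -/
noncomputable def slotWeight (l : ℕ) : Bool → ℕ
  | true => 2
  | false => slotPrime l - 2 * (l - 1)

theorem slotWeight_pos (l : ℕ) (b : Bool) : 0 < slotWeight l b := by
  have := lt_slotPrime l
  cases b <;> simp only [slotWeight] <;> omega

theorem eq_of_slotWeight_eq_slotPrime {l m n : ℕ} (hl : 2 ≤ l)
    (h : m * slotWeight l true + n * slotWeight l false = slotPrime l) : m = l - 1 ∧ n = 1 := by
  have hlt := lt_slotPrime l
  obtain ⟨k, hk⟩ := (slotPrime_prime l).odd_of_ne_two (by omega)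
  simp only [slotWeight] at h
  -- The prime is odd, so `n` is odd; `n ≥ 3` is too large because `3 (p - 2 (l - 1)) > p` when `p ≥
  -- 3 l + 2`.
  rcases lt_or_ge n 3 with hn | hn
  · interval_cases n <;> omega
  · have := Nat.mul_le_mul_right (slotPrime l - 2 * (l - 1)) hn
    omega

/-- The digits of a generator. -/
noncomputable def generatorDigits (g : Slot × Bool) : Set ℕ →₀ ℕ →₀ ℕ :=
  Finsupp.single g.1.1.1 (Finsupp.single g.1.1.2 (slotWeight g.1.1.2 g.2))

/-- A submonoid of `ℚ^(Set ℕ)` in which the basis vector of `L` has the length set `L`. -/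
noncomputable def lengthMonoid : AddSubmonoid (Set ℕ →₀ ℚ) :=
  AddSubmonoid.closure (Set.range fun g ↦ familyValue (generatorDigits g))

theorem lengthMonoid_le_mrange : lengthMonoid ≤ AddMonoidHom.mrange familyValue :=
  AddSubmonoid.closure_le.2 fun _ ⟨g, hg⟩ ↦ ⟨generatorDigits g, hg⟩

/-- The generators as elements of `lengthMonoid`. -/
noncomputable def generator (g : Slot × Bool) : lengthMonoid :=
  ⟨familyValue (generatorDigits g), AddSubmonoid.subset_closure ⟨g, rfl⟩⟩

theorem exists_multiset_generator (x : lengthMonoid) :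
    ∃ s : Multiset (Slot × Bool), (s.map generator).sum = x := by
  obtain ⟨x, hx⟩ := x
  induction hx using AddSubmonoid.closure_induction with
  | mem x hx =>
    obtain ⟨g, rfl⟩ := hx
    exact ⟨{g}, by simp [generator]⟩
  | zero => exact ⟨0, rfl⟩
  | add x y hx hy ihx ihy =>
    obtain ⟨s, hs⟩ := ihx
    obtain ⟨t, ht⟩ := ihy
    exact ⟨s + t, by rw [Multiset.map_add, Multiset.sum_add, hs, ht]; rfl⟩

theorem coe_sum_generator (s : Multiset (Slot × Bool)) :
    ((s.map generator).sum : Set ℕ →₀ ℚ) = familyValue (s.map generatorDigits).sum := by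
  rw [map_multiset_sum, Multiset.map_map, ← AddSubmonoid.coe_subtype, map_multiset_sum,
    Multiset.map_map]
  rfl

/-- The factorization of length `l` attached to a pair `(L, l)`. -/
def slotFactorization (q : Slot) : Multiset (Slot × Bool) :=
  Multiset.replicate (q.1.2 - 1) (q, true) + {(q, false)}

theorem card_slotFactorization (q : Slot) : (slotFactorization q).card = q.1.2 := by
  have := q.2.2
  simp only [slotFactorization, Multiset.card_add, Multiset.card_replicate, Multiset.card_singleton]
  omega

theorem eq_of_mem_slotFactorization {q : Slot} {g : Slot × Bool} (h : g ∈ slotFactorization q) :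
    g.1 = q := by
  rw [slotFactorization, Multiset.mem_add, Multiset.mem_singleton] at h
  rcases h with h | rfl
  · rw [Multiset.eq_of_mem_replicate h]
  · rfl

theorem sum_slotFactorization (q : Slot) :
    (((slotFactorization q).map generator).sum : Set ℕ →₀ ℚ) = Finsupp.single q.1.1 1 := by
  have hsum : (q.1.2 - 1) * slotWeight q.1.2 true + slotWeight q.1.2 false = slotPrime q.1.2 := by
    have := lt_slotPrime q.1.2
    simp only [slotWeight]
    omega
  rw [coe_sum_generator, slotFactorization, Multiset.map_add, Multiset.map_replicate,
    Multiset.map_singleton, Multiset.sum_add, Multiset.sum_replicate, Multiset.sum_singleton]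
  simp only [generatorDigits]
  rw [Finsupp.smul_single, Finsupp.smul_single, ← Finsupp.single_add, ← Finsupp.single_add,
    smul_eq_mul, hsum, familyValue_single, digitValue_single,
    div_self (cast_slotPrime_ne_zero _)]

theorem eq_slotFactorization_of_sum_eq {L : Set ℕ} {s : Multiset (Slot × Bool)}
    (h : ((s.map generator).sum : Set ℕ →₀ ℚ) = Finsupp.single L 1) :
    ∃ q : Slot, q.1.1 = L ∧ s = slotFactorization q := by
  classical
  rw [coe_sum_generator] at h
  set f := (s.map generatorDigits).sum with hf
  obtain ⟨l, hl⟩ : ∃ l, f L = Finsupp.single l (slotPrime l) := by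
    refine eq_single_of_digitValue_eq_one ?_
    rw [← familyValue_apply, h, Finsupp.single_eq_same]
  have hzero : ∀ L', L' ≠ L → f L' = 0 := fun L' hL' ↦ by
    rw [← digitValue_eq_zero_iff, ← familyValue_apply, h, Finsupp.single_eq_of_ne hL']
  -- Digits are natural numbers and cannot cancel, so each summand lives where `f` does.
  have hmem : ∀ g ∈ s, g.1.1 = (L, l) := fun g hg ↦ by
    have hle : generatorDigits g ≤ f :=
      Multiset.single_le_sum (fun _ _ ↦ zero_le) _ (Multiset.mem_map_of_mem _ hg)
    have hpos : f g.1.1.1 g.1.1.2 ≠ 0 := by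
      have := hle g.1.1.1 g.1.1.2
      rw [generatorDigits, Finsupp.single_eq_same, Finsupp.single_eq_same] at this
      exact ((slotWeight_pos _ _).trans_le this).ne'
    have hL : g.1.1.1 = L := by
      by_contra hne
      rw [hzero _ hne] at hpos
      exact hpos rfl
    refine Prod.ext hL ?_
    by_contra hne
    rw [hL, hl, Finsupp.single_eq_of_ne hne] at hpos
    exact hpos rfl
  have hs : s ≠ 0 := by
    rintro rfl
    have := DFunLike.congr_fun h L
    simp [hf] at this
  obtain ⟨g, hg⟩ := Multiset.exists_mem_of_ne_zero hs
  have hq : (L, l).2 ∈ (L, l).1 ∧ 2 ≤ (L, l).2 := hmem g hg ▸ g.1.2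
  refine ⟨⟨(L, l), hq⟩, rfl, ?_⟩
  obtain ⟨m, n, hmn⟩ := Multiset.exists_eq_replicate_add_replicate
    (u := ((⟨(L, l), hq⟩, true) : Slot × Bool)) (v := (⟨(L, l), hq⟩, false)) (s := s)
    fun g hg ↦ by
      obtain ⟨⟨q, hq'⟩, b⟩ := g
      obtain rfl : q = (L, l) := hmem _ hg
      cases b <;> simp
  have hw : m * slotWeight l true + n * slotWeight l false = slotPrime l := by
    have := DFunLike.congr_fun hl l
    rw [hf, hmn, Multiset.map_add, Multiset.map_replicate, Multiset.map_replicate,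
      Multiset.sum_add, Multiset.sum_replicate, Multiset.sum_replicate] at this
    simpa [generatorDigits] using this
  obtain ⟨rfl, rfl⟩ := eq_of_slotWeight_eq_slotPrime hq.2 hw
  rw [hmn, slotFactorization, Multiset.replicate_one]

theorem addIrreducible_generator (g : Slot × Bool) : AddIrreducible (generator g) := by
  classical
  have := subsingleton_addUnits_of_isPositiveSubmonoid
    (isPositiveSubmonoid_of_le_mrange lengthMonoid_le_mrange)
  have hg : g ∈ slotFactorization g.1 := by
    have := g.1.2.2
    obtain ⟨q, _ | _⟩ := g
    · simp [slotFactorization]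
    · have hne : q.1.2 - 1 ≠ 0 := by simp only at this; omega
      exact Multiset.mem_add.2 (.inl (Multiset.mem_replicate.2 ⟨hne, rfl⟩))
  have hcard := card_slotFactorization g.1
  have hl := g.1.2.2
  set r := (slotFactorization g.1).erase g with hr
  have hgr : g ::ₘ r = slotFactorization g.1 := Multiset.cons_erase hg
  rw [← hgr, Multiset.card_cons] at hcard
  -- As `l ≥ 2`, a second generator `a` remains; it ties any new factorization of `e_L` to the same
  -- slot, hence to the same length.
  obtain ⟨a, ha⟩ : ∃ a, a ∈ r := Multiset.card_pos_iff_exists_mem.1 (by omega)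
  -- A decomposition of `g` may be substituted for `g` only if it has length one.
  have key : ∀ s : Multiset (Slot × Bool), (s.map generator).sum = generator g → s.card = 1 := by
    intro s hs
    have hsum := sum_slotFactorization g.1
    rw [← hgr, Multiset.map_cons, Multiset.sum_cons, ← hs, ← Multiset.sum_add,
      ← Multiset.map_add] at hsum
    obtain ⟨q, -, hq⟩ := eq_slotFactorization_of_sum_eq hsum
    have h1 : a.1 = q := eq_of_mem_slotFactorization (hq ▸ Multiset.mem_add.2 (.inr ha))
    have h2 : a.1 = g.1 := eq_of_mem_slotFactorization (Multiset.mem_of_mem_erase ha)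
    have h3 := congr_arg Multiset.card hq
    rw [card_slotFactorization, Multiset.card_add, ← h1, h2] at h3
    omega
  refine ⟨fun hu ↦ ?_, fun {x y} hxy ↦ ?_⟩
  · rw [isAddUnit_iff_eq_zero] at hu
    have := key 0 hu.symm
    simp at this
  · obtain ⟨s, rfl⟩ := exists_multiset_generator x
    obtain ⟨t, rfl⟩ := exists_multiset_generator y
    rw [← Multiset.sum_add, ← Multiset.map_add] at hxy
    have := key _ hxy.symm
    rw [Multiset.card_add] at this
    rcases Nat.eq_zero_or_pos s.card with h | h
    · left
      rw [Multiset.card_eq_zero.1 h]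
      simp
    · right
      rw [Multiset.card_eq_zero.1 (show t.card = 0 by omega)]
      simp

theorem exists_generator_of_addIrreducible {x : lengthMonoid} (hx : AddIrreducible x) :
    ∃ g, generator g = x := by
  have := subsingleton_addUnits_of_isPositiveSubmonoid
    (isPositiveSubmonoid_of_le_mrange lengthMonoid_le_mrange)
  obtain ⟨s, rfl⟩ := exists_multiset_generator x
  induction s using Multiset.induction with
  | empty => exact (hx.not_isAddUnit isAddUnit_zero).elim
  | cons g s ih =>
    rw [Multiset.map_cons, Multiset.sum_cons] at hx ⊢
    rcases hx.isAddUnit_or_isAddUnit rfl with h | h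
    · exact ((addIrreducible_generator g).not_isAddUnit h).elim
    · exact ⟨g, by rw [isAddUnit_iff_eq_zero.1 h, add_zero]⟩

theorem card_image_addIrreducible_eq {L : Set ℕ} (hL : ∀ n ∈ L, 2 ≤ n) {x : lengthMonoid}
    (hx : (x : Set ℕ →₀ ℚ) = Finsupp.single L 1) :
    Multiset.card '' {t : Multiset lengthMonoid | (∀ b ∈ t, AddIrreducible b) ∧ t.sum = x} = L := by
  ext n
  constructor
  · rintro ⟨t, ⟨ht, rfl⟩, rfl⟩
    have : CanLift lengthMonoid (Slot × Bool) generator AddIrreducible :=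
      ⟨fun _ h ↦ exists_generator_of_addIrreducible h⟩
    lift t to Multiset (Slot × Bool) using ht with s
    obtain ⟨q, rfl, rfl⟩ := eq_slotFactorization_of_sum_eq hx
    rw [Multiset.card_map, card_slotFactorization]
    exact q.2.1
  · intro hn
    let q : Slot := ⟨(L, n), hn, hL n hn⟩
    refine ⟨(slotFactorization q).map generator, ⟨fun b hb ↦ ?_, ?_⟩, ?_⟩
    · obtain ⟨g, -, rfl⟩ := Multiset.mem_map.1 hb
      exact addIrreducible_generator g
    · exact Subtype.ext ((sum_slotFactorization q).trans hx.symm)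
    · rw [Multiset.card_map, card_slotFactorization]

theorem theorem1p1 {D : Type*} [CommRing D] [IsDomain D] (hD : SatisfiesACCP D) :
    ∃ (Ω : Type) (M : AddSubmonoid (Ω →₀ ℚ)), IsPositiveSubmonoid M ∧
      IsDomain (AddMonoidAlgebra D M) ∧
      SatisfiesACCP (AddMonoidAlgebra D M) ∧
      ∀ L : Set ℕ, L.Nonempty → (∀ n ∈ L, 2 ≤ n) → L ∈ lengthSystem (AddMonoidAlgebra D M) := by
  have hpos := isPositiveSubmonoid_of_le_mrange lengthMonoid_le_mrange
  have := twoUniqueSums_addSubmonoid lengthMonoid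
  have := subsingleton_addUnits_of_isPositiveSubmonoid hpos
  have hdom : IsDomain (AddMonoidAlgebra D lengthMonoid) := inferInstance
  have := satisfiesACCP_iff_wfDvdMonoid.1 hD
  refine ⟨Set ℕ, lengthMonoid, hpos, hdom, satisfiesACCP_iff_wfDvdMonoid.2
    (wfDvdMonoid_addMonoidAlgebra_of_le_mrange lengthMonoid_le_mrange), fun L ⟨n, hn⟩ hL ↦ ?_⟩
  -- The choice of `n` is immaterial: the sum below is always `e_L`, and `L` is nonempty so that
  -- `e_L` lies in `M`.
  let q : Slot := ⟨(L, n), hn, hL n hn⟩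
  let x := ((slotFactorization q).map generator).sum
  refine ⟨AddMonoidAlgebra.single x 1, by simp, ?_⟩
  rw [AddMonoidAlgebra.lengthSet_single_one]
  exact card_image_addIrreducible_eq hL (sum_slotFactorization q)
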